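/- Theorem (m-accretive restrictions of the derivative on $[a,b]$). Let $a,b\in\mathbb{R}$ with $a<b$, and let $$\partial\colon H^1([a,b];\mathbb{R})\subseteq L_2([a,b];\mathbb{R})\to L_2([a,b];\mathbb{R}),\quad u\mapsto u',$$ where $u'$ is the distributional derivative on $(a,b)$ and $H^1([a,b];\mathbb{R})=\{u\in L_2([a,b];\mathbb{R})\,;\,u'\in L_2([a,b];\mathbb{R})\}$. For $u\in H^1([a,b];\mathbb{R})$ and $t\in[a,b]$, let $u(t)$ be the value at $t$ of the continuous representative of $u$ on $[a,b]$. A relation $B\subseteq H\times H$ on a real Hilbert space $H$ is called accretive if $\langle x-u,y-v\rangle\geq 0$ for all $(u,v),(x,y)\in B$, and m-accretive if moreover for each $f\in H$ there is $(u,v)\in B$ with $u+v=f$; its domain is $\operatorname{dom}(B)=\{u\in H\,;\,\exists v\in H:\ (u,v)\in B\}$. Let $B\subseteq\partial$ (an arbitrary, not necessarily linear, restriction of $\partial$, as an inclusion of graphs in $L_2([a,b];\mathbb{R})\times L_2([a,b];\mathbb{R})$). Then $B$ is m-accretive if and only if there exists a function $g\colon\mathbb{R}\to\mathbb{R}$ with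 $$|g(c)-g(d)|\leq \mathrm{e}^{a+b}|c-d|\quad\text{for all } c,d\in\mathbb{R}$$ such that $$\operatorname{dom}(B)=\left\{u\in H^1([a,b];\mathbb{R})\,;\,\frac{u(a)\mathrm{e}^{-a}-u(b)\mathrm{e}^{-b}}{\mathrm{e}^{-2a}-\mathrm{e}^{-2b}}=g\left(\frac{u(b)\mathrm{e}^{b}-u(a)\mathrm{e}^{a}}{\mathrm{e}^{2b}-\mathrm{e}^{2a}}\right)\right\}.$$ -/

import Mathlib

open MeasureTheory Set
open scoped ContDiff

noncomputable section

namespace AccretiveDeriv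

/-- A (possibly nonlinear, possibly multivalued) relation `B ⊆ H × H` on a real Hilbert space is
accretive if `⟪x - u, y - v⟫ ≥ 0` for all `(u, v), (x, y) ∈ B`. -/
def IsAccretive {H : Type*} [NormedAddCommGroup H] [InnerProductSpace ℝ H]
    (B : Set (H × H)) : Prop :=
  ∀ p ∈ B, ∀ q ∈ B, 0 ≤ inner ℝ (q.1 - p.1) (q.2 - p.2)

/-- `B` is m-accretive if it is accretive and `1 + B` is onto. -/
def IsMAccretive {H : Type*} [NormedAddCommGroup H] [InnerProductSpace ℝ H]
    (B : Set (H × H)) : Prop :=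
  IsAccretive B ∧ ∀ f : H, ∃ p ∈ B, p.1 + p.2 = f

/-- The domain of a relation. -/
def dom {H : Type*} (B : Set (H × H)) : Set H :=
  {u | ∃ v, (u, v) ∈ B}

/-- The real Hilbert space `L₂([a,b]; ℝ)` with Lebesgue measure. -/
abbrev L2 (a b : ℝ) : Type := Lp ℝ 2 (volume.restrict (Icc a b))

/-- `v` is the distributional derivative of `u` on the open interval `(a, b)`. -/
def IsWeakDeriv (a b : ℝ) (u v : L2 a b) : Prop :=
  ∀ φ : ℝ → ℝ, ContDiff ℝ ∞ φ → HasCompactSupport φ → tsupport φ ⊆ Ioo a b →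
    ∫ t in Icc a b, u t * deriv φ t = -∫ t in Icc a b, v t * φ t

/-- The operator `∂ : H¹([a,b]) ⊆ L₂([a,b]) → L₂([a,b])`, `u ↦ u'`, as the set of pairs `(u, u')`
(its graph). -/
def derivOp (a b : ℝ) : Set (L2 a b × L2 a b) :=
  {p | IsWeakDeriv a b p.1 p.2}

/-- The Sobolev space `H¹([a,b]; ℝ)` of those `u ∈ L₂([a,b])` that have a distributional derivative
in `L₂([a,b])`. -/
def H1 (a b : ℝ) : Set (L2 a b) :=
  {u | ∃ v : L2 a b, IsWeakDeriv a b u v}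

/-- `w` is continuous on the closed interval `[a,b]` and represents the class `u`. -/
def IsContRep (a b : ℝ) (u : L2 a b) (w : ℝ → ℝ) : Prop :=
  ContinuousOn w (Icc a b) ∧ u =ᵐ[volume.restrict (Icc a b)] w

open Classical in
/-- The value `u(t)` at `t ∈ [a,b]` of the continuous representative of `u`. Every element of
`H¹([a,b])` has one; the default `0` is only taken at classes without a continuous
representative. -/
def pointValue (a b : ℝ) (u : L2 a b) (t : ℝ) : ℝ :=
  if h : ∃ w : ℝ → ℝ, IsContRep a b u w then h.choose t else 0

/-- For `a < b` the point values do not depend on the choice of the continuous representative. -/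
theorem pointValue_eq {a b : ℝ} (hab : a < b) {u : L2 a b} {w : ℝ → ℝ}
    (hw : IsContRep a b u w) {t : ℝ} (ht : t ∈ Icc a b) : pointValue a b u t = w t := by
  have h : ∃ w : ℝ → ℝ, IsContRep a b u w := ⟨w, hw⟩
  have hc := h.choose_spec
  have hae : h.choose =ᵐ[volume.restrict (Icc a b)] w := hc.2.symm.trans hw.2
  have := Measure.eqOn_Icc_of_ae_eq volume hab.ne hae hc.1 hw.1 ht
  simpa [pointValue, h] using this

end AccretiveDeriv

end

/-! Accretivity is a condition on boundary values only: by Green's formula (`two_mul_inner_sub`),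
`2⟪d, d'⟫ = d(b)² - d(a)²` for a difference `d` of two elements of the domain. Take `p e⁻ᵗ + q eᵗ`
with the boundary values of `d`. The mixed terms at `a` and `b` agree, so `d(b)² - d(a)²` is a
positive multiple of `(e^(a+b) q)² - p²` (`sq_sub_sq_eq`). Hence `B` is accretive iff `p` is an
`e^(a+b)`-Lipschitz function of `q` on `dom B` (`isAccretive_iff`).

The range condition separates the two coefficients. Since `(eᵗ u)' = eᵗ (u + u')`, the datum `f = u
+ u'` determines `q` (`growthCoeff_pointValue`), and every real `q` arises from some `f`. The
solutions of `u + u' = f` differ by multiples of `e⁻ᵗ`, so `p` is free and singles out the solution.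
Thus `1 + B` is onto exactly when the Lipschitz function is defined on all of `ℝ` and `dom B`
contains every `u ∈ H¹` with `p = g q`. -/

namespace AccretiveDeriv

open MeasureTheory Set
open scoped ContDiff

/-- `w` is absolutely continuous on `[a,b]` with almost everywhere derivative `v`. -/
structure HasACDeriv (a b : ℝ) (w v : ℝ → ℝ) : Prop where
  ac : AbsolutelyContinuousOnInterval w a b
  hasDerivAt : ∀ᵐ t ∂volume.restrict (Icc a b), HasDerivAt w (v t) t

/-! ### Test functions and the du Bois-Reymond lemma -/

section TestFunctions

variable {a b : ℝ}

theorem exists_Icc_of_isCompact_subset_Ioo (hab : a < b) {K : Set ℝ} (hK : IsCompact K)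
    (hKab : K ⊆ Ioo a b) : ∃ c d, a < c ∧ c ≤ d ∧ d < b ∧ K ⊆ Icc c d := by
  -- Adjoining a point makes the compact set nonempty, so that its extrema exist even for empty `K`.
  obtain ⟨m, hm⟩ := exists_between hab
  have hK' : IsCompact (insert m K) := hK.insert m
  have hsub : insert m K ⊆ Ioo a b := insert_subset hm hKab
  obtain ⟨c, hc⟩ := hK'.exists_isLeast (insert_nonempty _ _)
  obtain ⟨d, hd⟩ := hK'.exists_isGreatest (insert_nonempty _ _)
  exact ⟨c, d, (hsub hc.1).1, hc.2 hd.1, (hsub hd.1).2,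
    fun x hx => ⟨hc.2 (mem_insert_of_mem _ hx), hd.2 (mem_insert_of_mem _ hx)⟩⟩

theorem setIntegral_Icc_eq_intervalIntegral (hab : a ≤ b) (f : ℝ → ℝ) :
    ∫ t in Icc a b, f t = ∫ t in a..b, f t := by
  rw [intervalIntegral.integral_of_le hab, integral_Icc_eq_integral_Ioc]

/-- A test function on `(a,b)` with integral zero is the derivative of a test function. -/
theorem exists_antideriv_of_integral_eq_zero (hab : a < b) {h : ℝ → ℝ} (hs : ContDiff ℝ ∞ h)
    (hc : HasCompactSupport h) (hsub : tsupport h ⊆ Ioo a b) (h0 : ∫ t in a..b, h t = 0) :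
    ∃ φ : ℝ → ℝ, ContDiff ℝ ∞ φ ∧ HasCompactSupport φ ∧ tsupport φ ⊆ Ioo a b ∧ deriv φ = h := by
  obtain ⟨c, d, hac, hcd, hdb, hK⟩ := exists_Icc_of_isCompact_subset_Ioo hab hc hsub
  have hcont := hs.continuous
  have hder : ∀ t, HasDerivAt (fun x => ∫ s in a..x, h s) (h t) t := fun t =>
    intervalIntegral.integral_hasDerivAt_right (hcont.intervalIntegrable _ _)
      hcont.stronglyMeasurable.stronglyMeasurableAtFilter hcont.continuousAt
  have hderiv : deriv (fun x => ∫ s in a..x, h s) = h := funext fun t => (hder t).deriv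
  have hz : ∀ t ∉ Icc c d, h t = 0 := fun t ht =>
    image_eq_zero_of_notMem_tsupport fun h' => ht (hK h')
  have hts : tsupport (fun x => ∫ s in a..x, h s) ⊆ Icc c d := by
    refine closure_minimal ?_ isClosed_Icc
    intro t ht
    by_contra hcon
    apply ht
    rcases not_and_or.1 hcon with h1 | h1 <;> push Not at h1
    · change ∫ s in a..t, h s = 0
      rw [intervalIntegral.integral_congr (g := fun _ => 0), intervalIntegral.integral_zero]
      intro s hs
      refine hz s fun h2 => ?_
      have := hs.2.trans_lt (max_lt hac h1)
      exact absurd h2.1 (not_le.2 this)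
    -- To the right of the support, the primitive vanishes because the total integral does.
    · change ∫ s in a..t, h s = 0
      rw [← intervalIntegral.integral_add_adjacent_intervals (hcont.intervalIntegrable a b)
        (hcont.intervalIntegrable b t), h0, zero_add,
        intervalIntegral.integral_congr (g := fun _ => 0), intervalIntegral.integral_zero]
      intro s hs
      refine hz s fun h2 => ?_
      have := (lt_min hdb h1).trans_le hs.1
      exact absurd h2.2 (not_le.2 this)
  refine ⟨_, ?_, isCompact_Icc.of_isClosed_subset (isClosed_tsupport _) hts,
    hts.trans (Icc_subset_Ioo hac hdb), hderiv⟩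
  rw [contDiff_infty_iff_deriv]
  exact ⟨fun t => (hder t).differentiableAt, by rwa [hderiv]⟩

theorem exists_test_integral_eq_one (hab : a < b) : ∃ ψ : ℝ → ℝ, ContDiff ℝ ∞ ψ ∧
    HasCompactSupport ψ ∧ tsupport ψ ⊆ Ioo a b ∧ ∫ t in a..b, ψ t = 1 := by
  let f : ContDiffBump ((a + b) / 2) :=
    { rIn := (b - a) / 8, rOut := (b - a) / 4, rIn_pos := by linarith, rIn_lt_rOut := by linarith }
  have hsub : tsupport (f.normed volume) ⊆ Ioo a b := by
    rw [f.tsupport_normed_eq, Real.closedBall_eq_Icc]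
    refine Icc_subset_Ioo ?_ ?_ <;> simp only [f] <;> linarith
  refine ⟨f.normed volume, f.contDiff_normed, f.hasCompactSupport_normed, hsub, ?_⟩
  rw [← setIntegral_Icc_eq_intervalIntegral hab.le, setIntegral_eq_integral_of_forall_compl_eq_zero,
    f.integral_normed]
  exact fun x hx => image_eq_zero_of_notMem_tsupport fun h => hx (Ioo_subset_Icc_self (hsub h))

theorem ae_restrict_Icc_of_ae_Ioo {p : ℝ → Prop} (h : ∀ᵐ t, t ∈ Ioo a b → p t) :
    ∀ᵐ t ∂volume.restrict (Icc a b), p t := by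
  rw [← restrict_Ioo_eq_restrict_Icc]
  exact (ae_restrict_iff' measurableSet_Ioo).2 h

theorem ae_eq_zero_of_integral_test_eq_zero {f : ℝ → ℝ}
    (hf : IntegrableOn f (Icc a b))
    (h : ∀ φ : ℝ → ℝ, ContDiff ℝ ∞ φ → HasCompactSupport φ → tsupport φ ⊆ Ioo a b →
      ∫ t in Icc a b, f t * φ t = 0) :
    ∀ᵐ t ∂volume.restrict (Icc a b), f t = 0 := by
  refine ae_restrict_Icc_of_ae_Ioo (isOpen_Ioo.ae_eq_zero_of_integral_contDiff_smul_eq_zero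
    (hf.mono_set Ioo_subset_Icc_self).locallyIntegrableOn fun g hg hc hsub => ?_)
  rw [← h g hg hc hsub, setIntegral_eq_integral_of_forall_compl_eq_zero]
  · simp only [smul_eq_mul, mul_comm]
  · intro x hx
    rw [image_eq_zero_of_notMem_tsupport fun h => hx (Ioo_subset_Icc_self (hsub h)), mul_zero]

/-- The lemma of du Bois-Reymond on a bounded interval. -/
theorem ae_eq_const_of_integral_mul_deriv_eq_zero (hab : a < b) {f : ℝ → ℝ}
    (hf : IntegrableOn f (Icc a b))
    (h : ∀ φ : ℝ → ℝ, ContDiff ℝ ∞ φ → HasCompactSupport φ → tsupport φ ⊆ Ioo a b →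
      ∫ t in Icc a b, f t * deriv φ t = 0) :
    ∃ c, ∀ᵐ t ∂volume.restrict (Icc a b), f t = c := by
  obtain ⟨ψ, hψ, hψc, hψs, hψ1⟩ := exists_test_integral_eq_one hab
  have hmul : ∀ g : ℝ → ℝ, Continuous g → IntegrableOn (fun t => f t * g t) (Icc a b) :=
    fun g hg => hf.mul_continuousOn hg.continuousOn isCompact_Icc
  refine ⟨∫ t in Icc a b, f t * ψ t, ?_⟩
  set c := ∫ t in Icc a b, f t * ψ t with hcdef
  have hconst : IntegrableOn (fun _ : ℝ => c) (Icc a b) := by simp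
  have := ae_eq_zero_of_integral_test_eq_zero (f := fun t => f t - c) (hf.sub hconst) ?_
  · filter_upwards [this] with t ht using sub_eq_zero.1 ht
  intro φ hφ hφc hφs
  set m := ∫ t in a..b, φ t with hm
  -- Removing `m ψ` from `φ` leaves integral zero, so the difference is an admissible derivative
  -- `Φ'`.
  obtain ⟨Φ, hΦ, hΦc, hΦs, hΦd⟩ := exists_antideriv_of_integral_eq_zero hab
    (h := fun t => φ t - m * ψ t) (hφ.sub (contDiff_const.mul hψ))
    (hφc.sub hψc.mul_left)
    ((tsupport_sub _ _).trans (union_subset hφs ((closure_mono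
      (Function.support_mul_subset_right _ _)).trans hψs)))
    (by
      rw [intervalIntegral.integral_sub (hφ.continuous.intervalIntegrable _ _)
        ((hψ.continuous.intervalIntegrable _ _).const_mul m),
        intervalIntegral.integral_const_mul, hψ1, ← hm]; ring)
  have key := h Φ hΦ hΦc hΦs
  rw [hΦd] at key
  have e1 : ∀ t, f t * (φ t - m * ψ t) = f t * φ t - m * (f t * ψ t) := fun t => by ring
  simp only [e1] at key
  rw [integral_sub (hmul _ hφ.continuous) ((hmul _ hψ.continuous).const_mul m),
    integral_const_mul, ← hcdef] at key
  simp only [sub_mul]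
  rw [integral_sub (hmul _ hφ.continuous)
    ((hφ.continuous.integrableOn_Icc).const_mul c), integral_const_mul,
    setIntegral_Icc_eq_intervalIntegral hab.le φ, ← hm]
  linarith

end TestFunctions

/-! ### Calculus of absolutely continuous functions -/

namespace HasACDeriv

variable {a b : ℝ} {w w₁ w₂ v v₁ v₂ : ℝ → ℝ}

theorem continuousOn (hab : a ≤ b) (h : HasACDeriv a b w v) : ContinuousOn w (Icc a b) := by
  simpa [uIcc_of_le hab] using h.ac.continuousOn

theorem congr (h : HasACDeriv a b w v₁) (hv : v₁ =ᵐ[volume.restrict (Icc a b)] v₂) :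
    HasACDeriv a b w v₂ :=
  ⟨h.ac, by filter_upwards [h.hasDerivAt, hv] with t h1 h2 using h2 ▸ h1⟩

theorem sub (h₁ : HasACDeriv a b w₁ v₁) (h₂ : HasACDeriv a b w₂ v₂) :
    HasACDeriv a b (fun t => w₁ t - w₂ t) (fun t => v₁ t - v₂ t) :=
  ⟨h₁.ac.fun_sub h₂.ac, by
    filter_upwards [h₁.hasDerivAt, h₂.hasDerivAt] with t h1 h2 using h1.fun_sub h2⟩

theorem mul (h₁ : HasACDeriv a b w₁ v₁) (h₂ : HasACDeriv a b w₂ v₂) :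
    HasACDeriv a b (fun t => w₁ t * w₂ t) (fun t => v₁ t * w₂ t + w₁ t * v₂ t) :=
  ⟨h₁.ac.fun_mul h₂.ac, by
    filter_upwards [h₁.hasDerivAt, h₂.hasDerivAt] with t h1 h2 using h1.fun_mul h2⟩

theorem of_contDiff (h : ContDiff ℝ 1 w) : HasACDeriv a b w (deriv w) :=
  ⟨h.contDiffOn.absolutelyContinuousOnInterval,
    .of_forall fun t => (h.differentiable one_ne_zero t).hasDerivAt⟩

theorem primitive (hab : a ≤ b) (hv : IntegrableOn v (Icc a b)) (c : ℝ) :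
    HasACDeriv a b (fun t => c + ∫ s in a..t, v s) v := by
  have hi : IntervalIntegrable v volume a b :=
    (intervalIntegrable_iff_integrableOn_Icc_of_le hab).2 hv
  have ha : a ∈ uIcc a b := left_mem_uIcc
  refine ⟨(of_contDiff (w := fun _ => c) contDiff_const).ac.fun_add
    (hi.absolutelyContinuousOnInterval_intervalIntegral ha), ?_⟩
  rw [ae_restrict_iff' measurableSet_Icc]
  filter_upwards [hi.ae_hasDerivAt_integral] with t ht hmem
  exact (ht (by rwa [uIcc_of_le hab]) a ha).const_add c

theorem integral_eq (hab : a ≤ b) (h : HasACDeriv a b w v) :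
    ∫ t in Icc a b, v t = w b - w a := by
  rw [← h.ac.integral_deriv_eq_sub, ← setIntegral_Icc_eq_intervalIntegral hab]
  exact integral_congr_ae (by filter_upwards [h.hasDerivAt] with t ht using ht.deriv.symm)

end HasACDeriv

/-! ### Weak derivatives and absolutely continuous representatives -/

section WeakDeriv

variable {a b : ℝ}

theorem L2.integrableOn (u : L2 a b) : IntegrableOn u (Icc a b) :=
  (Lp.memLp u).integrable one_le_two

theorem HasACDeriv.integral_mul_deriv_test (hab : a ≤ b) {w v φ : ℝ → ℝ}
    (hw : HasACDeriv a b w v) (hv : IntegrableOn v (Icc a b)) (hφ : ContDiff ℝ ∞ φ)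
    (hsub : tsupport φ ⊆ Ioo a b) :
    ∫ t in Icc a b, w t * deriv φ t = -∫ t in Icc a b, v t * φ t := by
  have hz : ∀ t ∉ Ioo a b, φ t = 0 := fun t ht =>
    image_eq_zero_of_notMem_tsupport fun h => ht (hsub h)
  have hp := (hw.mul (HasACDeriv.of_contDiff (hφ.of_le (by simp)))).integral_eq hab
  have hwφ : IntegrableOn (fun t => w t * deriv φ t) (Icc a b) :=
    ((hw.continuousOn hab).mul (hφ.continuous_deriv (by simp)).continuousOn).integrableOn_Icc
  rw [hz a (by simp), hz b (by simp), integral_add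
    (hv.mul_continuousOn hφ.continuous.continuousOn isCompact_Icc) hwφ] at hp
  linarith

theorem isWeakDeriv_of_hasACDeriv (hab : a ≤ b) {u v : L2 a b} {w : ℝ → ℝ}
    (hw : HasACDeriv a b w v) (hu : u =ᵐ[volume.restrict (Icc a b)] w) : IsWeakDeriv a b u v := by
  intro φ hφ hc hsub
  rw [← hw.integral_mul_deriv_test hab v.integrableOn hφ hsub]
  exact integral_congr_ae (by filter_upwards [hu] with t ht using by rw [ht])

theorem IsWeakDeriv.unique {u v₁ v₂ : L2 a b} (h₁ : IsWeakDeriv a b u v₁)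
    (h₂ : IsWeakDeriv a b u v₂) : v₁ = v₂ := by
  refine Lp.ext ?_
  have := ae_eq_zero_of_integral_test_eq_zero (v₁.integrableOn.sub v₂.integrableOn)
    fun φ hφ hc hsub => ?_
  · filter_upwards [this] with t ht using sub_eq_zero.1 ht
  have := (h₁ φ hφ hc hsub).symm.trans (h₂ φ hφ hc hsub)
  simp only [Pi.sub_apply, sub_mul]
  rw [integral_sub (v₁.integrableOn.mul_continuousOn hφ.continuous.continuousOn isCompact_Icc)
    (v₂.integrableOn.mul_continuousOn hφ.continuous.continuousOn isCompact_Icc)]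
  linarith

/-- A class with a weak derivative `v ∈ L₂` has an absolutely continuous representative whose
almost everywhere derivative is `v`. -/
theorem IsWeakDeriv.exists_hasACDeriv (hab : a < b) {u v : L2 a b} (h : IsWeakDeriv a b u v) :
    ∃ w : ℝ → ℝ, HasACDeriv a b w v ∧ u =ᵐ[volume.restrict (Icc a b)] w := by
  have hP := HasACDeriv.primitive hab.le v.integrableOn 0
  set P : ℝ → ℝ := fun t => 0 + ∫ s in a..t, v s with hPdef
  have hPc := hP.continuousOn hab.le
  -- `u - P` has weak derivative zero, hence is almost everywhere constant.
  obtain ⟨c, hc⟩ := ae_eq_const_of_integral_mul_deriv_eq_zero hab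
    (u.integrableOn.sub hPc.integrableOn_Icc) fun φ hφ hcs hsub => by
      have hφ' : ContinuousOn (deriv φ) (Icc a b) := (hφ.continuous_deriv (by simp)).continuousOn
      have hPφ : IntegrableOn (fun t => P t * deriv φ t) (Icc a b) := (hPc.mul hφ').integrableOn_Icc
      simp only [Pi.sub_apply, sub_mul]
      rw [integral_sub (u.integrableOn.mul_continuousOn hφ' isCompact_Icc) hPφ, h φ hφ hcs hsub,
        hP.integral_mul_deriv_test hab.le v.integrableOn hφ hsub, sub_self]
  refine ⟨_, HasACDeriv.primitive hab.le v.integrableOn c, ?_⟩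
  filter_upwards [hc] with t ht
  simp only [Pi.sub_apply, hPdef] at ht
  linarith

theorem pointValue_eq_of_hasACDeriv (hab : a < b) {u : L2 a b} {w v : ℝ → ℝ}
    (hw : HasACDeriv a b w v) (hu : u =ᵐ[volume.restrict (Icc a b)] w) {t : ℝ}
    (ht : t ∈ Icc a b) : pointValue a b u t = w t :=
  pointValue_eq hab ⟨hw.continuousOn hab.le, hu⟩ ht

end WeakDeriv

/-! ### Algebra of the boundary coefficients -/

section Boundary

variable {a b : ℝ}

/-- The coefficient `p` of the function `p e⁻ᵗ + q eᵗ` with boundary values `α` at `a`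
and `β` at `b`. -/
noncomputable def decayCoeff (a b α β : ℝ) : ℝ :=
  (α * Real.exp (-a) - β * Real.exp (-b)) / (Real.exp (-2 * a) - Real.exp (-2 * b))

/-- The coefficient `q` of the function `p e⁻ᵗ + q eᵗ` with boundary values `α` at `a`
and `β` at `b`. -/
noncomputable def growthCoeff (a b α β : ℝ) : ℝ :=
  (β * Real.exp b - α * Real.exp a) / (Real.exp (2 * b) - Real.exp (2 * a))

theorem decayCoeff_sub (α β α' β' : ℝ) :
    decayCoeff a b (α - α') (β - β') = decayCoeff a b α β - decayCoeff a b α' β' := by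
  unfold decayCoeff
  rw [← sub_div]
  ring

theorem growthCoeff_sub (α β α' β' : ℝ) :
    growthCoeff a b (α - α') (β - β') = growthCoeff a b α β - growthCoeff a b α' β' := by
  unfold growthCoeff
  rw [← sub_div]
  ring

theorem exp_two_mul_sub_pos (hab : a < b) : 0 < Real.exp (2 * b) - Real.exp (2 * a) :=
  sub_pos.2 (Real.exp_lt_exp.2 (by linarith))

/-- This is `α = p e⁻ᵃ + q eᵃ` solved for `p`. -/
theorem decayCoeff_eq (hab : a < b) (α β : ℝ) :
    decayCoeff a b α β = Real.exp a * (α - Real.exp a * growthCoeff a b α β) := by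
  have hD := exp_two_mul_sub_pos hab
  unfold decayCoeff growthCoeff
  have e2 : ∀ x : ℝ, Real.exp (2 * x) = Real.exp x ^ 2 := fun x => by
    rw [← Real.exp_nat_mul]; norm_num
  have e3 : ∀ x : ℝ, Real.exp (-2 * x) = (Real.exp x ^ 2)⁻¹ := fun x => by
    rw [← e2, ← Real.exp_neg]; ring_nf
  rw [e3, e3, e2, e2, Real.exp_neg, Real.exp_neg]
  rw [e2, e2] at hD
  have hA := Real.exp_pos a
  have hB := Real.exp_pos b
  generalize Real.exp a = A at *
  generalize Real.exp b = B at *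
  have h1 : (A ^ 2)⁻¹ - (B ^ 2)⁻¹ = (B ^ 2 - A ^ 2) / (A ^ 2 * B ^ 2) := by field_simp
  rw [h1]
  have := hD.ne'
  field_simp
  ring

/-- Squaring `p e⁻ᵗ + q eᵗ` at both end points gives the same mixed term `2pq`, which cancels; this
diagonalises the boundary form. -/
theorem sq_sub_sq_eq (hab : a < b) (α β : ℝ) :
    Real.exp (a + b) ^ 2 * (β ^ 2 - α ^ 2) = (Real.exp (2 * b) - Real.exp (2 * a)) *
      ((Real.exp (a + b) * growthCoeff a b α β) ^ 2 - decayCoeff a b α β ^ 2) := by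
  have hD := exp_two_mul_sub_pos hab
  have hq : growthCoeff a b α β * (Real.exp (2 * b) - Real.exp (2 * a)) =
      β * Real.exp b - α * Real.exp a := div_mul_cancel₀ _ hD.ne'
  have e2 : ∀ x : ℝ, Real.exp (2 * x) = Real.exp x ^ 2 := fun x => by
    rw [← Real.exp_nat_mul]; norm_num
  rw [decayCoeff_eq hab, Real.exp_add, e2, e2]
  rw [e2, e2] at hq
  have hβ : β = (growthCoeff a b α β * (Real.exp b ^ 2 - Real.exp a ^ 2) + α * Real.exp a) /
      Real.exp b := by
    rw [hq, sub_add_cancel, mul_div_cancel_right₀ _ (Real.exp_ne_zero b)]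
  have hB := Real.exp_pos b
  generalize growthCoeff a b α β = q at *
  rw [hβ]
  field_simp
  ring

theorem sq_le_sq_iff_abs_decayCoeff_le (hab : a < b) (α β : ℝ) :
    α ^ 2 ≤ β ^ 2 ↔ |decayCoeff a b α β| ≤ Real.exp (a + b) * |growthCoeff a b α β| := by
  have h := sq_sub_sq_eq hab α β
  have hD := exp_two_mul_sub_pos hab
  have hE : 0 < Real.exp (a + b) ^ 2 := by positivity
  rw [← abs_of_pos (Real.exp_pos (a + b)), ← abs_mul, ← sq_le_sq,
    ← sub_nonneg, ← mul_nonneg_iff_of_pos_left hE, h, mul_nonneg_iff_of_pos_left hD, sub_nonneg]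

theorem eq_of_coeffs_eq (hab : a < b) {α β α' β' : ℝ}
    (hp : decayCoeff a b α β = decayCoeff a b α' β')
    (hq : growthCoeff a b α β = growthCoeff a b α' β') : α = α' ∧ β = β' := by
  rw [decayCoeff_eq hab, decayCoeff_eq hab, hq] at hp
  have h1 : α = α' := by
    have := mul_left_cancel₀ (Real.exp_ne_zero a) hp
    linarith
  subst h1
  refine ⟨rfl, ?_⟩
  have := (div_left_inj' (exp_two_mul_sub_pos hab).ne').1 hq
  exact mul_right_cancel₀ (Real.exp_ne_zero b) (sub_left_injective this)

end Boundary

/-! ### The derivative operator and its m-accretive restrictions -/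

section DerivOp

variable {a b : ℝ}

/-- Green's formula for the difference of two elements of the graph of the derivative. -/
theorem two_mul_inner_sub (hab : a < b) {p q : L2 a b × L2 a b} (hp : p ∈ derivOp a b)
    (hq : q ∈ derivOp a b) :
    2 * inner ℝ (q.1 - p.1) (q.2 - p.2) =
      (pointValue a b q.1 b - pointValue a b p.1 b) ^ 2 -
        (pointValue a b q.1 a - pointValue a b p.1 a) ^ 2 := by
  obtain ⟨w, hw, hpw⟩ := IsWeakDeriv.exists_hasACDeriv hab hp
  obtain ⟨z, hz, hqz⟩ := IsWeakDeriv.exists_hasACDeriv hab hq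
  have ha := left_mem_Icc.2 hab.le
  have hb := right_mem_Icc.2 hab.le
  rw [pointValue_eq_of_hasACDeriv hab hw hpw ha, pointValue_eq_of_hasACDeriv hab hw hpw hb,
    pointValue_eq_of_hasACDeriv hab hz hqz ha, pointValue_eq_of_hasACDeriv hab hz hqz hb,
    sq, sq, ← ((hz.sub hw).mul (hz.sub hw)).integral_eq hab.le, MeasureTheory.L2.inner_def,
    ← integral_const_mul]
  refine integral_congr_ae ?_
  filter_upwards [hpw, hqz, Lp.coeFn_sub q.1 p.1, Lp.coeFn_sub q.2 p.2] with t h1 h2 h3 h4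
  rw [h3, h4]
  simp only [Pi.sub_apply, h1, h2, RCLike.inner_apply, conj_trivial]
  ring

/-- The integrating factor `eᵗ` turns `u + u'` into the total derivative of `eᵗ u`. -/
theorem integral_exp_mul_add (hab : a < b) {p : L2 a b × L2 a b} (hp : p ∈ derivOp a b) :
    ∫ t in Icc a b, Real.exp t * (p.1 + p.2 : L2 a b) t =
      pointValue a b p.1 b * Real.exp b - pointValue a b p.1 a * Real.exp a := by
  obtain ⟨w, hw, hpw⟩ := IsWeakDeriv.exists_hasACDeriv hab hp
  rw [pointValue_eq_of_hasACDeriv hab hw hpw (left_mem_Icc.2 hab.le),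
    pointValue_eq_of_hasACDeriv hab hw hpw (right_mem_Icc.2 hab.le),
    ← (hw.mul (HasACDeriv.of_contDiff Real.contDiff_exp)).integral_eq hab.le]
  refine integral_congr_ae ?_
  filter_upwards [hpw, Lp.coeFn_add p.1 p.2] with t h1 h2
  rw [h2, Pi.add_apply, h1, Real.deriv_exp]
  ring

theorem growthCoeff_pointValue (hab : a < b) {p : L2 a b × L2 a b} (hp : p ∈ derivOp a b) :
    growthCoeff a b (pointValue a b p.1 a) (pointValue a b p.1 b) =
      (∫ t in Icc a b, Real.exp t * (p.1 + p.2 : L2 a b) t) /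
        (Real.exp (2 * b) - Real.exp (2 * a)) := by
  rw [integral_exp_mul_add hab hp, growthCoeff]

/-- The equation `u + u' = f` is solvable with prescribed value at the left end point. -/
theorem exists_add_eq (hab : a < b) (f : L2 a b) (c : ℝ) :
    ∃ p ∈ derivOp a b, p.1 + p.2 = f ∧ pointValue a b p.1 a = c := by
  have hfi : IntegrableOn (fun t => Real.exp t * f t) (Icc a b) :=
    f.integrableOn.continuousOn_mul Real.continuous_exp.continuousOn isCompact_Icc
  -- Variation of constants: `w(t) = e⁻ᵗ (c eᵃ + ∫ₐᵗ eˢ f(s) ds)`.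
  have hw := (HasACDeriv.of_contDiff (a := a) (b := b) (Real.contDiff_exp.comp contDiff_neg)).mul
    (HasACDeriv.primitive hab.le hfi (c * Real.exp a))
  set w : ℝ → ℝ := fun t => (Real.exp ∘ Neg.neg) t *
    (c * Real.exp a + ∫ s in a..t, Real.exp s * f s) with hwdef
  have hcont := hw.continuousOn hab.le
  have hmem : MemLp w 2 (volume.restrict (Icc a b)) := by
    obtain ⟨C, hC⟩ := isCompact_Icc.exists_bound_of_continuousOn hcont
    exact MemLp.of_bound (hcont.aestronglyMeasurable measurableSet_Icc) C
      ((ae_restrict_iff' measurableSet_Icc).2 (.of_forall hC))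
  have hu := hmem.coeFn_toLp
  set u : L2 a b := hmem.toLp w
  have hd : ∀ t, deriv (Real.exp ∘ Neg.neg) t = -Real.exp (-t) := fun t => by
    simpa using ((Real.hasDerivAt_exp (-t)).comp t (hasDerivAt_neg t)).deriv
  have hw' : HasACDeriv a b w (f - u : L2 a b) := by
    refine hw.congr ?_
    filter_upwards [Lp.coeFn_sub f u, hu] with t h1 h2
    rw [h1, Pi.sub_apply, h2, hd, hwdef]
    have : Real.exp (-t) * Real.exp t = 1 := by rw [← Real.exp_add]; simp
    simp only [Function.comp_apply]
    linear_combination (f t) * this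
  refine ⟨(u, f - u), isWeakDeriv_of_hasACDeriv hab.le hw' hu, by simp, ?_⟩
  rw [pointValue_eq_of_hasACDeriv hab hw' hu (left_mem_Icc.2 hab.le), hwdef]
  simp [mul_left_comm, ← Real.exp_add]

theorem exists_add_eq_decayCoeff_eq (hab : a < b) (f : L2 a b) {r s : ℝ}
    (hs : s = (∫ t in Icc a b, Real.exp t * f t) / (Real.exp (2 * b) - Real.exp (2 * a))) :
    ∃ p ∈ derivOp a b, p.1 + p.2 = f ∧
      growthCoeff a b (pointValue a b p.1 a) (pointValue a b p.1 b) = s ∧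
      decayCoeff a b (pointValue a b p.1 a) (pointValue a b p.1 b) = r := by
  -- The left end value is `decayCoeff_eq` solved for `α`, with coefficients `r` and `s`.
  obtain ⟨p, hp, hpf, hpc⟩ := exists_add_eq hab f (r / Real.exp a + Real.exp a * s)
  have hq := growthCoeff_pointValue hab hp
  rw [hpf, ← hs] at hq
  refine ⟨p, hp, hpf, hq, ?_⟩
  rw [decayCoeff_eq hab, hq, hpc, add_sub_cancel_right, mul_div_cancel₀ _ (Real.exp_ne_zero a)]

theorem exists_integral_exp_mul_eq (hab : a < b) (r : ℝ) :
    ∃ f : L2 a b, ∫ t in Icc a b, Real.exp t * f t = r := by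
  have hne : Real.exp b - Real.exp a ≠ 0 := (sub_pos.2 (Real.exp_lt_exp.2 hab)).ne'
  refine ⟨Lp.const 2 _ (r / (Real.exp b - Real.exp a)), ?_⟩
  rw [integral_congr_ae (g := fun t => Real.exp t * (r / (Real.exp b - Real.exp a)))
    (by filter_upwards [Lp.coeFn_const (p := 2) (μ := volume.restrict (Icc a b))
          (r / (Real.exp b - Real.exp a))] with t ht using by rw [ht, Function.const_apply]),
    integral_mul_const, setIntegral_Icc_eq_intervalIntegral hab.le, integral_exp]
  field_simp

/-- Elements of the graph of `∂` are determined by `u + u'` and the boundary values of `u`. -/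
theorem eq_of_add_eq_of_coeffs_eq (hab : a < b) {p q : L2 a b × L2 a b} (hp : p ∈ derivOp a b)
    (hq : q ∈ derivOp a b) (hadd : p.1 + p.2 = q.1 + q.2)
    (h : decayCoeff a b (pointValue a b p.1 a) (pointValue a b p.1 b) =
      decayCoeff a b (pointValue a b q.1 a) (pointValue a b q.1 b)) : p = q := by
  have hg : growthCoeff a b (pointValue a b p.1 a) (pointValue a b p.1 b) =
      growthCoeff a b (pointValue a b q.1 a) (pointValue a b q.1 b) := by
    rw [growthCoeff_pointValue hab hp, growthCoeff_pointValue hab hq, hadd]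
  obtain ⟨h1, h2⟩ := eq_of_coeffs_eq hab h hg
  have hin := two_mul_inner_sub hab hp hq
  -- The difference `d` satisfies `d' = -d` with zero boundary values, so Green's formula reads
  -- `-2‖d‖² = 0`.
  have h3 : q.2 - p.2 = -(q.1 - p.1) := by
    rw [eq_neg_iff_add_eq_zero, ← sub_eq_zero.2 hadd.symm]; abel
  rw [h1, h2, h3, inner_neg_right, real_inner_self_eq_norm_sq] at hin
  have h4 : ‖q.1 - p.1‖ ^ 2 = 0 := by linarith
  have h5 : p.1 = q.1 := (sub_eq_zero.1 (norm_eq_zero.1 (pow_eq_zero_iff two_ne_zero |>.1 h4))).symm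
  exact Prod.ext h5 (by rw [h5] at hadd; exact add_left_cancel hadd)

/-- A restriction of `∂` is accretive iff the first coefficient depends on the second one in a
Lipschitz continuous way. -/
theorem isAccretive_iff (hab : a < b) {B : Set (L2 a b × L2 a b)} (hB : B ⊆ derivOp a b) :
    IsAccretive B ↔ ∀ u ∈ dom B, ∀ x ∈ dom B,
      |decayCoeff a b (pointValue a b x a) (pointValue a b x b) -
        decayCoeff a b (pointValue a b u a) (pointValue a b u b)| ≤
      Real.exp (a + b) * |growthCoeff a b (pointValue a b x a) (pointValue a b x b) -
        growthCoeff a b (pointValue a b u a) (pointValue a b u b)| := by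
  have key : ∀ p ∈ B, ∀ q ∈ B, 0 ≤ inner ℝ (q.1 - p.1) (q.2 - p.2) ↔
      |decayCoeff a b (pointValue a b q.1 a) (pointValue a b q.1 b) -
        decayCoeff a b (pointValue a b p.1 a) (pointValue a b p.1 b)| ≤
      Real.exp (a + b) * |growthCoeff a b (pointValue a b q.1 a) (pointValue a b q.1 b) -
        growthCoeff a b (pointValue a b p.1 a) (pointValue a b p.1 b)| := fun p hp q hq => by
    rw [← decayCoeff_sub, ← growthCoeff_sub, ← sq_le_sq_iff_abs_decayCoeff_le hab,
      ← sub_nonneg (b := (_ - _) ^ 2),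
      ← two_mul_inner_sub hab (hB hp) (hB hq), mul_nonneg_iff_of_pos_left two_pos]
  constructor
  · rintro h u ⟨v, hv⟩ x ⟨y, hy⟩
    exact (key _ hv _ hy).1 (h _ hv _ hy)
  · intro h p hp q hq
    exact (key p hp q hq).2 (h _ ⟨p.2, hp⟩ _ ⟨q.2, hq⟩)

/-- A restriction of `∂` is m-accretive iff its domain is cut out of `H¹` by prescribing the first
coefficient as a Lipschitz continuous function of the second one. -/
theorem isMAccretive_iff (hab : a < b) {B : Set (L2 a b × L2 a b)} (hB : B ⊆ derivOp a b) :
    IsMAccretive B ↔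
      ∃ g : ℝ → ℝ, (∀ c d : ℝ, |g c - g d| ≤ Real.exp (a + b) * |c - d|) ∧
        dom B = {u | u ∈ H1 a b ∧
          decayCoeff a b (pointValue a b u a) (pointValue a b u b) =
            g (growthCoeff a b (pointValue a b u a) (pointValue a b u b))} := by
  rw [IsMAccretive, isAccretive_iff hab hB]
  constructor
  · rintro ⟨hacc, hsurj⟩
    have hex : ∀ s : ℝ, ∃ u ∈ dom B,
        growthCoeff a b (pointValue a b u a) (pointValue a b u b) = s := fun s => by
      obtain ⟨f, hf⟩ := exists_integral_exp_mul_eq hab (s * (Real.exp (2 * b) - Real.exp (2 * a)))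
      obtain ⟨p, hp, hpf⟩ := hsurj f
      refine ⟨p.1, ⟨p.2, hp⟩, ?_⟩
      rw [growthCoeff_pointValue hab (hB hp), hpf, hf,
        mul_div_cancel_right₀ _ (exp_two_mul_sub_pos hab).ne']
    choose U hU hUs using hex
    refine ⟨fun s => decayCoeff a b (pointValue a b (U s) a) (pointValue a b (U s) b),
      fun c d => ?_, ?_⟩
    · simpa only [hUs] using hacc _ (hU d) _ (hU c)
    -- By the Lipschitz bound, equal growth coefficients force equal decay coefficients, so the
    -- choice of `U` does not matter.
    have hgraph : ∀ u ∈ dom B, decayCoeff a b (pointValue a b u a) (pointValue a b u b) =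
        decayCoeff a b
          (pointValue a b (U (growthCoeff a b (pointValue a b u a) (pointValue a b u b))) a)
          (pointValue a b (U (growthCoeff a b (pointValue a b u a) (pointValue a b u b))) b) := by
      intro u hu
      have := hacc _ (hU (growthCoeff a b (pointValue a b u a) (pointValue a b u b))) u hu
      rw [hUs, sub_self, abs_zero, mul_zero] at this
      exact sub_eq_zero.1 (abs_nonpos_iff.1 this)
    refine Set.ext fun u => ⟨fun hu => ⟨?_, hgraph u hu⟩, ?_⟩
    · obtain ⟨v, hv⟩ := hu
      exact ⟨v, hB hv⟩
    · rintro ⟨⟨v, hv⟩, hu⟩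
      -- The element of `B` solving for the datum `u + v` shares both coefficients with `u`, hence
      -- equals `(u, v)`.
      obtain ⟨p, hp, hpf⟩ := hsurj (u + v)
      have hq : growthCoeff a b (pointValue a b p.1 a) (pointValue a b p.1 b) =
          growthCoeff a b (pointValue a b u a) (pointValue a b u b) := by
        rw [growthCoeff_pointValue hab (hB hp), hpf]
        exact (growthCoeff_pointValue hab (p := (u, v)) hv).symm
      have h := hgraph p.1 ⟨p.2, hp⟩
      rw [hq] at h
      have heq : p = (u, v) := eq_of_add_eq_of_coeffs_eq hab (hB hp) hv hpf (h.trans hu.symm)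
      exact ⟨v, heq ▸ hp⟩
  · rintro ⟨g, hg, hdom⟩
    refine ⟨fun u hu x hx => ?_, fun f => ?_⟩
    · rw [hdom] at hu hx
      rw [hu.2, hx.2]
      exact hg _ _
    -- `f` fixes the growth coefficient; the free decay coefficient is set to its value under `g`.
    · obtain ⟨p, hp, hpf, hs, hr⟩ := exists_add_eq_decayCoeff_eq hab f (r := g _) rfl
      have hmem : p.1 ∈ dom B := by
        rw [hdom]
        exact ⟨⟨p.2, hp⟩, by rw [hr, hs]⟩
      obtain ⟨v, hv⟩ := hmem
      -- Membership in `dom B` provides only some `v`; uniqueness of the weak derivative identifies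
      -- it.
      have : v = p.2 := IsWeakDeriv.unique (hB hv) hp
      subst this
      exact ⟨p, hv, hpf⟩

end DerivOp

end AccretiveDeriv

theorem mainTheorem3 (a b : ℝ) (hab : a < b)
    (B : Set (AccretiveDeriv.L2 a b × AccretiveDeriv.L2 a b))
    (hB : B ⊆ AccretiveDeriv.derivOp a b) :
    AccretiveDeriv.IsMAccretive B ↔
      ∃ g : ℝ → ℝ,
        (∀ c d : ℝ, |g c - g d| ≤ Real.exp (a + b) * |c - d|) ∧
        AccretiveDeriv.dom B =
          {u | u ∈ AccretiveDeriv.H1 a b ∧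
            (AccretiveDeriv.pointValue a b u a * Real.exp (-a)
                - AccretiveDeriv.pointValue a b u b * Real.exp (-b))
              / (Real.exp (-2 * a) - Real.exp (-2 * b))
            = g ((AccretiveDeriv.pointValue a b u b * Real.exp b
                - AccretiveDeriv.pointValue a b u a * Real.exp a)
              / (Real.exp (2 * b) - Real.exp (2 * a)))} :=
  AccretiveDeriv.isMAccretive_iff hab hB
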